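/- Let $m$ and $n$ be positive integers, and let $A$ and $B$ be $m\times n$ matrices with entries in a commutative ring. Let $U_n$ be the $n\times n$ matrix whose entries strictly above the diagonal are $1$ and whose other entries are $0$, and let $A^{i}$ and $B^{i}$ denote the $i$-th columns of $A$ and $B$. Then $$\det\bigl(AU_nB^t+BU_nA^t+AB^t\bigr)=\left(\sum_{1\le i_1\le j_1<i_2\le j_2<\cdots\le n}\det\bigl(A^{i_1}B^{j_1}A^{i_2}B^{j_2}\cdots\bigr)\right)\left(\sum_{1\le i_1<j_1\le i_2<j_2\le\cdots\le n}\det\bigl(B^{i_1}A^{j_1}B^{i_2}A^{j_2}\cdots\bigr)\right).$$ Here each determinant on the right-hand side is that of the $m\times m$ matrix obtained by concatenating $m$ columns, taken alternately from the two matrices. The summation indices are the $m$ indices of these columns: $i_1,j_1,\dots,i_{m/2},j_{m/2}$ if $m$ is even, and $i_1,j_1,\dots,j_{(m-1)/2},i_{(m+1)/2}$ if $m$ is odd. They lie in $\{1,\dots,n\}$, and the weak and strict inequalities between consecutive indices alternate as indicated. An empty sum is $0$. -/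

import Mathlib

/-- The `n × n` matrix with all entries strictly above the diagonal equal to `1` and all other
entries equal to `0`. -/
def upperOnes (R : Type*) [Zero R] [One R] (n : ℕ) : Matrix (Fin n) (Fin n) R :=
  Matrix.of fun i j => if i < j then 1 else 0

/-- The `m × m` matrix `A^{k₁} B^{k₂} A^{k₃} B^{k₄} ⋯` whose `p`-th column is the `k_p`-th column
of `A` or of `B` in turn, beginning with `A`. The positions are counted from `0` in `Fin m`,
so the columns of `A` stand at the even positions. -/
def altColumns {R : Type*} {m n : ℕ} (A B : Matrix (Fin m) (Fin n) R) (k : Fin m → Fin n) :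
    Matrix (Fin m) (Fin m) R :=
  Matrix.of fun r p => if Even (p : ℕ) then A r (k p) else B r (k p)

/-- `k₁ ≤ k₂ < k₃ ≤ k₄ < ⋯`, that is, `i₁ ≤ j₁ < i₂ ≤ j₂ < ⋯` for the sequence
`k = (i₁, j₁, i₂, j₂, …)` of length `m`, indexed from `0`. -/
def WeakStrict {m n : ℕ} (k : Fin m → Fin n) : Prop :=
  ∀ p q : Fin m, (p : ℕ) + 1 = (q : ℕ) →
    (Even (p : ℕ) → k p ≤ k q) ∧ (Odd (p : ℕ) → k p < k q)

/-- `k₁ < k₂ ≤ k₃ < k₄ ≤ ⋯`, that is, `i₁ < j₁ ≤ i₂ < j₂ ≤ ⋯` for the sequence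
`k = (i₁, j₁, i₂, j₂, …)` of length `m`, indexed from `0`. -/
def StrictWeak {m n : ℕ} (k : Fin m → Fin n) : Prop :=
  ∀ p q : Fin m, (p : ℕ) + 1 = (q : ℕ) →
    (Even (p : ℕ) → k p < k q) ∧ (Odd (p : ℕ) → k p ≤ k q)

instance {m n : ℕ} : DecidablePred (WeakStrict (m := m) (n := n)) := fun k => by
  unfold WeakStrict; infer_instance

instance {m n : ℕ} : DecidablePred (StrictWeak (m := m) (n := n)) := fun k => by
  unfold StrictWeak; infer_instance

open Matrix

/-! Let a, b be the sums of the columns of A, B and Y = A(U + 1)Bᵗ. As U + 1 + Uᵗ is the all-ones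
matrix, the matrix on the left is K + b aᵗ with K = Y − Yᵗ alternating (`mul_upperOnes_mul_eq`). For
even m, det(K + u vᵗ) = Pf(K) Pf(K + u vᵗ − v uᵗ) (`factorial_sq_mul_det_add_vecMulVec`), which is
where the two factors come from; odd m is reduced to even m by bordering.

Pfaffians live in the exterior algebra: if m = 2k and ω = ∑ Y r s e_r ∧ e_s, the top coefficient of
ω^k is k! Pf(K). Here ω is the sum of A^i ∧ B^j over i ≤ j, and adding b ∧ a turns it into the sum
of B^i ∧ A^j over i < j (`strictForm_eq_weakForm_add`). The k-th power of either form is k! times a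
sum of products over alternating chains (`chainSum_weak_even`, `chainSum_strict_even`). The
factorials are cancelled for generic matrices over ℤ, and the identity is then specialised. -/

/-- If `y` is square-zero and commutes with `x`, then `(x + y) ^ (n + 1)` has only two terms. -/
theorem add_pow_succ_of_sq_zero {S : Type*} [Ring S] {x y : S} (h : Commute x y) (hy : y * y = 0)
    (n : ℕ) : (x + y) ^ (n + 1) = x ^ (n + 1) + ((n + 1 : ℕ) : S) * (x ^ n * y) := by
  induction n with
  | zero => simp
  | succ n ih =>
    rw [pow_succ, ih]
    have h1 : x ^ n * y * x = x ^ (n + 1) * y := by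
      rw [mul_assoc, ← h.eq, ← mul_assoc, pow_succ]
    have h2 : x ^ n * y * y = 0 := by rw [mul_assoc, hy, mul_zero]
    simp only [add_mul, mul_add, mul_assoc ((n + 1 : ℕ) : S), h1, h2, ← pow_succ]
    push_cast
    noncomm_ring

/-! ### Quadratic elements of the exterior algebra and the top-degree functional. -/

namespace ExteriorAlgebra

variable {R : Type*} [CommRing R]

section General

variable {M : Type*} [AddCommGroup M] [Module R M]

theorem ι_mul_ι_swap (x y : M) : ι R x * ι R y = -(ι R y * ι R x) :=
  eq_neg_of_add_eq_zero_left (ι_add_mul_swap x y)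

theorem commute_ι_mul_ι_ι (x y z : M) : Commute (ι R x * ι R y) (ι R z) := by
  rw [commute_iff_eq, mul_assoc, ι_mul_ι_swap y z, mul_neg, ← mul_assoc, ι_mul_ι_swap x z]
  simp [mul_assoc]

theorem ι_mul_ι_mul_self (x y : M) : ι R x * ι R y * (ι R x * ι R y) = 0 := by
  rw [← mul_assoc, (commute_ι_mul_ι_ι x y x).eq, ← mul_assoc, ι_sq_zero, zero_mul, zero_mul]

theorem ι_mul_ι_mul_right (x y : M) : ι R x * ι R y * ι R x = 0 := by
  rw [(commute_ι_mul_ι_ι x y x).eq, ← mul_assoc, ι_sq_zero, zero_mul]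

end General

variable {m : ℕ}

/-- The quadratic element `∑ X r s • e_r ∧ e_s`, linear in the matrix `X`. -/
noncomputable def ofMatrix : Matrix (Fin m) (Fin m) R →ₗ[R] ExteriorAlgebra R (Fin m → R) where
  toFun X := ∑ r, ∑ s, X r s • (ι R (Pi.single r 1) * ι R (Pi.single s 1))
  map_add' X Y := by simp [add_smul, Finset.sum_add_distrib]
  map_smul' c X := by simp [mul_smul, Finset.smul_sum]

theorem ofMatrix_apply (X : Matrix (Fin m) (Fin m) R) :
    ofMatrix X = ∑ r, ∑ s, X r s • (ι R (Pi.single r 1) * ι R (Pi.single s 1)) := rfl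

theorem ι_eq_sum (x : Fin m → R) : ι R x = ∑ r, x r • ι R (Pi.single r (1 : R)) := by
  conv_lhs => rw [pi_eq_sum_univ' x]
  simp [map_sum]

theorem ofMatrix_vecMulVec (x y : Fin m → R) :
    ofMatrix (vecMulVec x y) = ι R x * ι R y := by
  rw [ι_eq_sum x, ι_eq_sum y, Finset.sum_mul_sum, ofMatrix_apply]
  simp [vecMulVec_apply, smul_smul, mul_comm]

theorem commute_ofMatrix_ι (X : Matrix (Fin m) (Fin m) R) (z : Fin m → R) :
    Commute (ofMatrix X) (ι R z) := by
  rw [ofMatrix_apply]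
  exact Commute.sum_left _ _ _ fun r _ => Commute.sum_left _ _ _ fun s _ =>
    (commute_ι_mul_ι_ι _ _ _).smul_left _

theorem ofMatrix_add_pow_succ (X : Matrix (Fin m) (Fin m) R) (u v : Fin m → R) (k : ℕ) :
    (ofMatrix X + ι R u * ι R v) ^ (k + 1) =
      ofMatrix X ^ (k + 1) + ((k + 1 : ℕ) : ExteriorAlgebra R (Fin m → R)) *
        (ofMatrix X ^ k * (ι R u * ι R v)) :=
  add_pow_succ_of_sq_zero ((commute_ofMatrix_ι X u).mul_right (commute_ofMatrix_ι X v))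
    (ι_mul_ι_mul_self u v) k

/-- The linear functional on the exterior algebra of `R ^ m` which is the determinant in degree
`m` and zero in the other degrees. -/
noncomputable def topDet (R : Type*) [CommRing R] (m : ℕ) :
    ExteriorAlgebra R (Fin m → R) →ₗ[R] R :=
  liftAlternating (Pi.single m Matrix.detRowAlternating)

theorem topDet_ιMulti (v : Fin m → Fin m → R) : topDet R m (ιMulti R m v) = det (of v) := by
  rw [topDet, liftAlternating_apply_ιMulti, Pi.single_eq_same]; rfl

theorem topDet_ιMulti_of_ne {i : ℕ} (h : i ≠ m) (v : Fin i → Fin m → R) :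
    topDet R m (ιMulti R i v) = 0 := by
  rw [topDet, liftAlternating_apply_ιMulti, Pi.single_eq_of_ne h]; rfl

theorem ιMulti_eq_zero_of_lt {i : ℕ} (h : m < i) : ιMulti R i (M := Fin m → R) = 0 := by
  refine Module.Basis.ext_alternating (Pi.basisFun R (Fin m)) fun v hv => ?_
  have := Fintype.card_le_of_injective v hv
  simp at this
  omega

theorem ofMatrix_mem (X : Matrix (Fin m) (Fin m) R) :
    ofMatrix X ∈ (LinearMap.range (ι R (M := Fin m → R))) ^ 2 := by
  rw [ofMatrix_apply]
  refine Submodule.sum_mem _ fun r _ => Submodule.sum_mem _ fun s _ => Submodule.smul_mem _ _ ?_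
  rw [pow_two]
  exact Submodule.mul_mem_mul ⟨_, rfl⟩ ⟨_, rfl⟩

theorem eq_zero_of_mem_pow {i : ℕ} (h : m < i) {x : ExteriorAlgebra R (Fin m → R)}
    (hx : x ∈ (LinearMap.range (ι R (M := Fin m → R))) ^ i) : x = 0 := by
  change x ∈ exteriorPower R i (Fin m → R) at hx
  rw [← ιMulti_span_fixedDegree, ιMulti_eq_zero_of_lt h] at hx
  refine (Submodule.mem_bot R).1 (Submodule.span_le.2 ?_ hx)
  rintro _ ⟨v, rfl⟩
  simp

theorem ofMatrix_induction {C : Matrix (Fin m) (Fin m) R → Prop} (zero : C 0)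
    (add : ∀ X Y, C X → C Y → C (X + Y)) (vecMulVec : ∀ u v, C (vecMulVec u v))
    (X : Matrix (Fin m) (Fin m) R) : C X := by
  induction X using Matrix.induction_on' with
  | h_zero => exact zero
  | h_add X Y hX hY => exact add X Y hX hY
  | h_std_basis i j x =>
    have : Matrix.single i j x = Matrix.vecMulVec (Pi.single i x) (Pi.single j 1) := by
      ext r s
      simp only [Matrix.single_apply, vecMulVec_apply, Pi.single_apply]
      grind
    exact this ▸ vecMulVec _ _

/-! ### Contraction and the first variation of the Pfaffian. -/

-- Contraction is an antiderivation, and it sends u ∧ v to (φ·u) v − (φ·v) u, which is −(X − Xᵗ)φ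
-- for X = u vᵗ.
open CliffordAlgebra in
theorem contractLeft_ofMatrix_mul (φ : Fin m → R) (X : Matrix (Fin m) (Fin m) R)
    (x : ExteriorAlgebra R (Fin m → R)) :
    contractLeft (Q := 0) (dotProductBilin R R φ) (ofMatrix X * x) =
      ofMatrix X * contractLeft (Q := 0) (dotProductBilin R R φ) x
        - ι R ((X - Xᵀ) *ᵥ φ) * x := by
  induction X using ofMatrix_induction with
  | zero => simp
  | add X Y hX hY =>
    have : X + Y - (X + Y)ᵀ = (X - Xᵀ) + (Y - Yᵀ) := by
      rw [transpose_add]; abel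
    simp only [map_add, add_mul, hX, hY, this, add_mulVec]
    abel
  | vecMulVec u v =>
    have h : (vecMulVec u v - (vecMulVec u v)ᵀ) *ᵥ φ = (φ ⬝ᵥ v) • u - (φ ⬝ᵥ u) • v := by
      ext i
      simp [transpose_vecMulVec, sub_mulVec, vecMulVec_mulVec, dotProduct_comm, mul_comm]
    rw [ofMatrix_vecMulVec, h, mul_assoc]
    erw [contractLeft_ι_mul, contractLeft_ι_mul]
    simp only [map_sub, map_smul, sub_mul, mul_sub, dotProductBilin_apply_apply, smul_mul_assoc,
      mul_smul_comm, mul_assoc]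
    abel

open CliffordAlgebra in
theorem contractLeft_ofMatrix_pow_mul (φ : Fin m → R) (X : Matrix (Fin m) (Fin m) R) (k : ℕ)
    (x : ExteriorAlgebra R (Fin m → R)) :
    contractLeft (Q := 0) (dotProductBilin R R φ) (ofMatrix X ^ (k + 1) * x) =
      ofMatrix X ^ (k + 1) * contractLeft (Q := 0) (dotProductBilin R R φ) x
        - (k + 1 : R) • (ofMatrix X ^ k * ι R ((X - Xᵀ) *ᵥ φ) * x) := by
  induction k generalizing x with
  | zero => simp [contractLeft_ofMatrix_mul]
  | succ k ih =>
    rw [pow_succ, mul_assoc, ih, contractLeft_ofMatrix_mul]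
    have := (commute_ofMatrix_ι X ((X - Xᵀ) *ᵥ φ)).eq
    have h2 : ofMatrix X ^ k * ι R ((X - Xᵀ) *ᵥ φ) * (ofMatrix X * x) =
        ofMatrix X ^ (k + 1) * ι R ((X - Xᵀ) *ᵥ φ) * x := by
      rw [← mul_assoc, mul_assoc _ _ (ofMatrix X), ← this, ← mul_assoc, pow_succ]
    rw [h2, mul_sub, ← mul_assoc, ← mul_assoc, ← pow_succ, sub_sub]
    congr 1
    push_cast
    module

/-- The first variation of the Pfaffian in a direction `(X - Xᵀ) φ ∧ v`. -/
theorem topDet_ofMatrix_pow_mul_mulVec {k : ℕ} (hm : m = 2 * (k + 1))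
    (X : Matrix (Fin m) (Fin m) R) (φ v : Fin m → R) :
    (k + 1 : R) * topDet R m (ofMatrix X ^ k * (ι R ((X - Xᵀ) *ᵥ φ) * ι R v)) =
      topDet R m (ofMatrix X ^ (k + 1)) * (φ ⬝ᵥ v) := by
  -- This product has degree m + 1, hence vanishes; contracting it with φ gives the identity.
  have h0 : ofMatrix X ^ (k + 1) * ι R v = 0 := by
    refine eq_zero_of_mem_pow (i := 2 * (k + 1) + 1) (by omega) ?_
    rw [pow_succ _ (2 * (k + 1)), pow_mul]
    exact Submodule.mul_mem_mul (Submodule.pow_mem_pow _ (ofMatrix_mem X) _) ⟨_, rfl⟩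
  have h := contractLeft_ofMatrix_pow_mul φ X k (ι R v)
  rw [h0, map_zero, eq_comm, sub_eq_zero] at h
  erw [CliffordAlgebra.contractLeft_ι] at h
  rw [dotProductBilin_apply_apply, ← Algebra.commutes, ← Algebra.smul_def] at h
  have := congrArg (topDet R m) h
  rw [map_smul, map_smul, smul_eq_mul, smul_eq_mul, mul_assoc (ofMatrix X ^ k)] at this
  rw [← this, mul_comm]

/-! ### Determinants and Pfaffians under rank one perturbations. -/

/-- The determinant of a rank one perturbation. -/
theorem det_add_vecMulVec [IsDomain R] (P : Matrix (Fin m) (Fin m) R) (hP : P.det ≠ 0)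
    (u v : Fin m → R) :
    (P + vecMulVec u v).det = P.det + (P.adjugate *ᵥ u) ⬝ᵥ v := by
  let K := FractionRing R
  let f := algebraMap R K
  have hf : Function.Injective f := IsFractionRing.injective R K
  apply hf
  have hu : IsUnit (P.map f).det := by
    rw [isUnit_iff_ne_zero, ← RingHom.mapMatrix_apply, ← RingHom.map_det]
    exact (map_ne_zero_iff f hf).2 hP
  have h := det_add_replicateCol_mul_replicateRow hu (f ∘ u) (f ∘ v) (ι := Unit)
  have hmap : (P + vecMulVec u v).map f =
      P.map f + replicateCol Unit (f ∘ u) * replicateRow Unit (f ∘ v) := by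
    ext i j
    simp [vecMulVec_apply, Matrix.mul_apply]
  have hinv : (P.map f)⁻¹ = (P.map f).det⁻¹ • (P.adjugate.map f) := by
    rw [Matrix.inv_def, Ring.inverse_eq_inv', ← RingHom.mapMatrix_apply, ← RingHom.mapMatrix_apply,
      RingHom.map_adjugate]
  have hs : (replicateRow Unit (f ∘ v) * (P.adjugate.map f) * replicateCol Unit (f ∘ u)).det =
      f ((P.adjugate *ᵥ u) ⬝ᵥ v) := by
    rw [Matrix.mul_assoc, det_unique (n := Unit)]
    simp [Matrix.mul_apply, dotProduct, mulVec, map_sum, mul_comm]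
  have hd : f P.det = (P.map f).det := by rw [RingHom.map_det, RingHom.mapMatrix_apply]
  rw [RingHom.map_det, RingHom.mapMatrix_apply, hmap, h, map_add, ← hs, hd, hinv, Matrix.mul_smul,
    Matrix.smul_mul, det_unique (n := Unit), det_unique (n := Unit), Matrix.add_apply, Matrix.one_apply_eq,
    Matrix.smul_apply, smul_eq_mul, mul_add, mul_one, mul_inv_cancel_left₀ hu.ne_zero]

/-- The first variation is taken at φ = adj(K) u with K = X − Xᵗ, so that Kφ = det(K) u; the
correction terms on both sides then agree. -/
theorem det_mul_topDet_ofMatrix_add [IsDomain R] {k : ℕ} (hm : m = 2 * (k + 1))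
    (X : Matrix (Fin m) (Fin m) R) (hX : (X - Xᵀ).det ≠ 0) (u v : Fin m → R) :
    (X - Xᵀ).det * topDet R m (ofMatrix (X + vecMulVec u v) ^ (k + 1)) =
      topDet R m (ofMatrix X ^ (k + 1)) * (X - Xᵀ + vecMulVec u v).det := by
  rw [map_add, ofMatrix_vecMulVec, ofMatrix_add_pow_succ, map_add, det_add_vecMulVec _ hX, mul_add,
    mul_add, mul_comm, ← topDet_ofMatrix_pow_mul_mulVec hm, mulVec_mulVec, mul_adjugate,
    smul_mulVec, one_mulVec, map_smul, smul_mul_assoc, mul_smul_comm, map_smul, smul_eq_mul,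
    ← nsmul_eq_mul, map_nsmul, nsmul_eq_mul]
  push_cast
  ring

/-- The square of the Pfaffian is multiplied by the same factor as the determinant under a
perturbation of rank two. -/
theorem topDet_sq_add_vecMulVec [IsDomain R] {k : ℕ} (hm : m = 2 * (k + 1)) {c : R}
    {X : Matrix (Fin m) (Fin m) R} {u v : Fin m → R} (hX : (X - Xᵀ).det ≠ 0)
    (hX' : (X + vecMulVec u v - (X + vecMulVec u v)ᵀ).det ≠ 0)
    (h : topDet R m (ofMatrix X ^ (k + 1)) ^ 2 = c * (X - Xᵀ).det) :
    topDet R m (ofMatrix (X + vecMulVec u v) ^ (k + 1)) ^ 2 =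
      c * (X + vecMulVec u v - (X + vecMulVec u v)ᵀ).det := by
  have h1 := det_mul_topDet_ofMatrix_add hm X hX u v
  -- Adding v uᵗ as well leaves the quadratic element of X, so the step can be retraced. Both
  -- directions involve the same determinant of X − Xᵗ + u vᵗ, which is then eliminated.
  have e1 : ofMatrix (X + vecMulVec u v + vecMulVec v u) = ofMatrix X := by
    rw [map_add, map_add, ofMatrix_vecMulVec, ofMatrix_vecMulVec, ι_mul_ι_swap u v]
    abel
  have h2 := det_mul_topDet_ofMatrix_add hm _ hX' v u
  have e2 : X + vecMulVec u v - (X + vecMulVec u v)ᵀ + vecMulVec v u =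
      X - Xᵀ + vecMulVec u v := by
    rw [transpose_add, transpose_vecMulVec]
    abel
  rw [e1, e2] at h2
  apply mul_left_cancel₀ hX
  generalize topDet R m (ofMatrix (X + vecMulVec u v) ^ (k + 1)) = T' at *
  generalize topDet R m (ofMatrix X ^ (k + 1)) = T at *
  generalize (X - Xᵀ + vecMulVec u v).det = D at *
  linear_combination T' * h1 - T * h2 + (X + vecMulVec u v - (X + vecMulVec u v)ᵀ).det * h

end ExteriorAlgebra

namespace ExteriorAlgebra

/-! ### Change of scalars. -/

section BaseChange

variable {S R : Type*} [CommRing S] [CommRing R] [Algebra S R] {m : ℕ}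

/-- Coordinatewise change of scalars on the exterior algebra of `S ^ m`. -/
noncomputable def piMap (S R : Type*) [CommRing S] [CommRing R] [Algebra S R] (m : ℕ) :
    ExteriorAlgebra S (Fin m → S) →ₐ[S] ExteriorAlgebra R (Fin m → R) :=
  lift S ⟨((ι R (M := Fin m → R)).restrictScalars S) ∘ₗ (Algebra.linearMap S R).compLeft (Fin m),
    fun x => by simp⟩

theorem piMap_ι (x : Fin m → S) : piMap S R m (ι S x) = ι R (algebraMap S R ∘ x) := by
  simp [piMap]
  rfl

theorem piMap_ofMatrix (X : Matrix (Fin m) (Fin m) S) :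
    piMap S R m (ofMatrix X) = ofMatrix (X.map (algebraMap S R)) := by
  have h (i : Fin m) : algebraMap S R ∘ Pi.single i (1 : S) = Pi.single i 1 := by
    ext j
    by_cases hij : j = i <;> simp [hij]
  simp only [ofMatrix_apply, map_sum, map_smul, map_mul, piMap_ι, h, Matrix.map_apply,
    algebraMap_smul]

theorem topDet_piMap (x : ExteriorAlgebra S (Fin m → S)) :
    topDet R m (piMap S R m x) = algebraMap S R (topDet S m x) := by
  have : (topDet R m).restrictScalars S ∘ₗ (piMap S R m).toLinearMap =
      Algebra.linearMap S R ∘ₗ topDet S m := by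
    refine lhom_ext fun i => ?_
    ext v
    have h : piMap S R m (ιMulti S i v) = ιMulti R i fun j => algebraMap S R ∘ v j := by
      simp [ιMulti_apply, map_list_prod, List.map_ofFn, Function.comp_def, piMap_ι]
    simp only [LinearMap.compAlternatingMap_apply, LinearMap.comp_apply,
      LinearMap.restrictScalars_apply, AlgHom.toLinearMap_apply, h, Algebra.linearMap_apply]
    obtain rfl | hi := eq_or_ne i m
    · rw [topDet_ιMulti, topDet_ιMulti, RingHom.map_det]
      rfl
    · rw [topDet_ιMulti_of_ne hi, topDet_ιMulti_of_ne hi, map_zero]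
  exact LinearMap.congr_fun this x

end BaseChange

variable {R : Type*} [CommRing R]

/-- The second conjunct serves the induction: it kills the pure power of the old sum, leaving the
mixed term with its factor N + 1. -/
theorem sum_ι_mul_ι_pow {M : Type*} [AddCommGroup M] [Module R M] (e : ℕ → M) (N : ℕ) :
    (∑ i ∈ Finset.range N, ι R (e (2 * i)) * ι R (e (2 * i + 1))) ^ N =
        (N.factorial : ExteriorAlgebra R M) * ιMulti R (2 * N) (fun i => e i) ∧
      (∑ i ∈ Finset.range N, ι R (e (2 * i)) * ι R (e (2 * i + 1))) ^ (N + 1) = 0 := by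
  induction N with
  | zero => simp
  | succ N ih =>
    have hc : Commute (∑ i ∈ Finset.range N, ι R (e (2 * i)) * ι R (e (2 * i + 1)))
        (ι R (e (2 * N)) * ι R (e (2 * N + 1))) :=
      Commute.sum_left _ _ _ fun i _ =>
        (commute_ι_mul_ι_ι _ _ _).mul_right (commute_ι_mul_ι_ι _ _ _)
    have hp := add_pow_succ_of_sq_zero hc (ι_mul_ι_mul_self _ _)
    rw [Finset.sum_range_succ, hp, hp, pow_succ _ (N + 1), ih.2, ih.1]
    refine ⟨?_, by simp⟩
    have : ιMulti R (2 * (N + 1)) (fun i => e i) =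
        ιMulti R (2 * N) (fun i => e i) * (ι R (e (2 * N)) * ι R (e (2 * N + 1))) := by
      change ιMulti R (2 * N + 1 + 1) (fun i => e i) = _
      rw [ιMulti_apply, List.ofFn_succ', List.prod_concat, List.ofFn_succ', List.prod_concat,
        mul_assoc, ιMulti_apply]
      rfl
    rw [this, Nat.factorial_succ]
    push_cast
    simp [mul_assoc]

variable {m : ℕ}

/-! ### The symplectic base point and the even Pfaffian identity. -/

/-- The block diagonal `2k × 2k` matrix with blocks `!![0, 1; 0, 0]`. -/
def halfSymplectic (R : Type*) [CommRing R] (k : ℕ) : Matrix (Fin (2 * k)) (Fin (2 * k)) R :=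
  ∑ i ∈ Finset.range k, vecMulVec (fun r => if (r : ℕ) = 2 * i then 1 else 0)
    (fun s => if (s : ℕ) = 2 * i + 1 then 1 else 0)

theorem halfSymplectic_apply (k : ℕ) (r s : Fin (2 * k)) :
    halfSymplectic R k r s = if Even (r : ℕ) ∧ (r : ℕ) + 1 = s then 1 else 0 := by
  rw [halfSymplectic, Matrix.sum_apply]
  simp only [vecMulVec_apply, mul_ite, mul_one, mul_zero, ← ite_and]
  split_ifs with h
  · rw [Finset.sum_eq_single ((r : ℕ) / 2)]
    · rw [if_pos]
      grind
    · intro b _ hb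
      rw [if_neg]
      grind
    · intro hb
      simp only [Finset.mem_range] at hb
      omega
  · refine Finset.sum_eq_zero fun i _ => if_neg ?_
    grind

theorem det_halfSymplectic (k : ℕ) :
    (halfSymplectic R k - (halfSymplectic R k)ᵀ).det = 1 := by
  let e : Fin 2 × Fin k ≃ Fin (2 * k) :=
    (Equiv.prodComm _ _).trans (finProdFinEquiv.trans (finCongr (mul_comm k 2)))
  rw [← det_submatrix_equiv_self e]
  have : (halfSymplectic R k - (halfSymplectic R k)ᵀ).submatrix e e =
      blockDiagonal fun _ : Fin k => (!![0, 1; -1, 0] : Matrix (Fin 2) (Fin 2) R) := by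
    ext ⟨a, i⟩ ⟨b, j⟩
    simp only [submatrix_apply, Matrix.sub_apply, transpose_apply, halfSymplectic_apply,
      blockDiagonal_apply]
    have h (c : Fin 2) (l : Fin k) : ((e (c, l) : Fin (2 * k)) : ℕ) = c + 2 * l := rfl
    simp only [h]
    fin_cases a <;> fin_cases b <;> simp <;> grind
  rw [this, det_blockDiagonal]
  simp

theorem topDet_halfSymplectic (k : ℕ) :
    topDet R (2 * k) (ofMatrix (halfSymplectic R k) ^ k) = k.factorial := by
  have h := (sum_ι_mul_ι_pow (R := R) (M := Fin (2 * k) → R)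
    (fun j r => if (r : ℕ) = j then 1 else 0) k).1
  rw [halfSymplectic, map_sum]
  simp only [ofMatrix_vecMulVec]
  rw [h, ← nsmul_eq_mul, map_nsmul, topDet_ιMulti, nsmul_eq_mul]
  have : (of fun i r : Fin (2 * k) => if (r : ℕ) = i then (1 : R) else 0) = 1 := by
    ext i j
    simp [Matrix.one_apply, Fin.ext_iff, eq_comm]
  rw [this, det_one, mul_one]

open Polynomial in
theorem det_X_smul_add_ne_zero [Nontrivial R] {n : Type*} [Fintype n] [DecidableEq n]
    (A B : Matrix n n R)
    (hA : A.det ≠ 0) : ((X : R[X]) • A.map C + B.map C).det ≠ 0 := by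
  intro h
  have := coeff_det_X_add_C_card A B
  rw [h, coeff_zero] at this
  exact hA this.symm

open Polynomial in
/-- The determinant of a rank one perturbation `Y - Yᵀ + u vᵀ` of an alternating matrix is the
product of the Pfaffians of `Y - Yᵀ` and of `Y - Yᵀ + u vᵀ - v uᵀ`. Each Pfaffian is multiplied by
`(k + 1)!` here. -/
theorem factorial_sq_mul_det_add_vecMulVec [IsDomain R] (k : ℕ)
    (Y : Matrix (Fin (2 * (k + 1))) (Fin (2 * (k + 1))) R) (u v : Fin (2 * (k + 1)) → R) :
    ((k + 1).factorial : R) ^ 2 * (Y - Yᵀ + vecMulVec u v).det =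
      topDet R _ (ofMatrix Y ^ (k + 1)) * topDet R _ (ofMatrix (Y + vecMulVec u v) ^ (k + 1)) := by
  -- The pencil X·J + Y keeps the alternating part nonsingular for every Y, since the top
  -- coefficient of its determinant is det(J − Jᵗ) = 1.
  let J := halfSymplectic R (k + 1)
  let L (Y : Matrix (Fin (2 * (k + 1))) (Fin (2 * (k + 1))) R) :
    Matrix (Fin (2 * (k + 1))) (Fin (2 * (k + 1))) R[X] := (X : R[X]) • J.map C + Y.map C
  -- This is Pf² = det along the pencil; it holds at Y = 0 and is propagated by rank one steps.
  let good (Y : Matrix (Fin (2 * (k + 1))) (Fin (2 * (k + 1))) R) : Prop :=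
    topDet R[X] _ (ofMatrix (L Y) ^ (k + 1)) ^ 2 =
      ((k + 1).factorial : R[X]) ^ 2 * (L Y - (L Y)ᵀ).det
  have hne (Y) : (L Y - (L Y)ᵀ).det ≠ 0 := by
    have : L Y - (L Y)ᵀ = (X : R[X]) • (J - Jᵀ).map C + (Y - Yᵀ).map C := by
      ext1 i j
      simp [L, mul_sub]
      ring
    rw [this]
    exact det_X_smul_add_ne_zero _ _ (by rw [det_halfSymplectic]; exact one_ne_zero)
  have hJ : J.map C = halfSymplectic R[X] (k + 1) := by
    ext1 i j
    simp [J, halfSymplectic_apply, apply_ite]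
  have h0 : good 0 := by
    have : L 0 = (X : R[X]) • halfSymplectic R[X] (k + 1) := by simp [L, hJ]
    simp only [good, this, map_smul, _root_.smul_pow, topDet_halfSymplectic, transpose_smul, ← smul_sub,
      det_smul, det_halfSymplectic, smul_eq_mul, Fintype.card_fin]
    ring
  have hstep (Y) : ∀ Z, good Z → good (Z + Y) := by
    induction Y using ofMatrix_induction with
    | zero => simp
    | add X Y hX hY => exact fun Z hZ => add_assoc Z X Y ▸ hY _ (hX _ hZ)
    | vecMulVec u v =>
      intro Z hZ
      have : L (Z + vecMulVec u v) = L Z + vecMulVec (C ∘ u) (C ∘ v) := by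
        ext1 i j
        simp [L, vecMulVec_apply, add_assoc]
      have hn := hne (Z + vecMulVec u v)
      simp only [good]
      rw [this] at hn ⊢
      exact topDet_sq_add_vecMulVec rfl (hne Z) hn hZ
  have hY : good Y := by simpa using hstep Y 0 h0
  have hmain : ((k + 1).factorial : R[X]) ^ 2 *
        (L Y - (L Y)ᵀ + vecMulVec (C ∘ u) (C ∘ v)).det =
      topDet R[X] _ (ofMatrix (L Y) ^ (k + 1)) *
        topDet R[X] _ (ofMatrix (L Y + vecMulVec (C ∘ u) (C ∘ v)) ^ (k + 1)) := by
    have h := det_mul_topDet_ofMatrix_add rfl (L Y) (hne Y) (C ∘ u) (C ∘ v)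
    simp only [good] at hY
    apply mul_left_cancel₀ (hne Y)
    linear_combination (-topDet R[X] _ (ofMatrix (L Y) ^ (k + 1))) * h -
      (L Y - (L Y)ᵀ + vecMulVec (C ∘ u) (C ∘ v)).det * hY
  -- Evaluation at 0 as the algebra structure makes `piMap` the specialisation of the pencil to Y.
  let _ : Algebra R[X] R := (evalRingHom (0 : R)).toAlgebra
  have ha (p : R[X]) : algebraMap R[X] R p = p.eval 0 := rfl
  have hL : (L Y).map (algebraMap R[X] R) = Y := by
    ext i j
    simp [L, ha]
  have hL' : (L Y + vecMulVec (C ∘ u) (C ∘ v)).map (algebraMap R[X] R) = Y + vecMulVec u v := by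
    ext i j
    simp [L, ha, vecMulVec_apply]
  have hdet : algebraMap R[X] R (L Y - (L Y)ᵀ + vecMulVec (C ∘ u) (C ∘ v)).det =
      (Y - Yᵀ + vecMulVec u v).det := by
    rw [RingHom.map_det, RingHom.mapMatrix_apply]
    congr 1
    ext
    simp [L, ha, vecMulVec_apply]
  have := congrArg (algebraMap R[X] R) hmain
  simpa only [map_mul, ← topDet_piMap, map_pow (piMap R[X] R _), piMap_ofMatrix, hL, hL',
    map_pow (algebraMap R[X] R), map_natCast, hdet] using this

/-! ### Bordering and the identity in odd size. -/

section Border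

variable {m : ℕ}

/-- The inclusion of `R ^ m` into `R ^ (m + 1)` as the last coordinates. -/
def consZero (R : Type*) [CommRing R] (m : ℕ) : (Fin m → R) →ₗ[R] (Fin (m + 1) → R) where
  toFun x := Fin.cons 0 x
  map_add' x y := by ext i; refine Fin.cases ?_ (fun _ => ?_) i <;> simp
  map_smul' c x := by ext i; refine Fin.cases ?_ (fun _ => ?_) i <;> simp

theorem consZero_apply (x : Fin m → R) : consZero R m x = Fin.cons 0 x := rfl

theorem topDet_map_consZero (x : ExteriorAlgebra R (Fin m → R)) :
    topDet R (m + 1) (map (consZero R m) x) = 0 := by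
  have : topDet R (m + 1) ∘ₗ (map (consZero R m)).toLinearMap = 0 := by
    refine lhom_ext fun i => ?_
    ext v
    simp only [LinearMap.compAlternatingMap_apply, LinearMap.comp_apply, AlgHom.toLinearMap_apply,
      map_apply_ιMulti]
    obtain rfl | hi := eq_or_ne i (m + 1)
    · rw [topDet_ιMulti]
      exact det_eq_zero_of_column_eq_zero 0 fun i => rfl
    · rw [topDet_ιMulti_of_ne hi]
      rfl
  exact LinearMap.congr_fun this x

theorem topDet_ι_mul_map_consZero (x : ExteriorAlgebra R (Fin m → R)) :
    topDet R (m + 1) (ι R (Pi.single 0 1) * map (consZero R m) x) = topDet R m x := by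
  have : topDet R (m + 1) ∘ₗ LinearMap.mulLeft R (ι R (Pi.single 0 1)) ∘ₗ
      (map (consZero R m)).toLinearMap = topDet R m := by
    refine lhom_ext fun i => ?_
    ext v
    have h : ι R (Pi.single 0 1) * ιMulti R i (consZero R m ∘ v) =
        ιMulti R (i + 1) (Fin.cons (Pi.single 0 1) (consZero R m ∘ v)) := by
      rw [ιMulti_succ_apply]
      rfl
    simp only [LinearMap.compAlternatingMap_apply, LinearMap.comp_apply, AlgHom.toLinearMap_apply,
      map_apply_ιMulti, LinearMap.mulLeft_apply, h]
    obtain rfl | hi := eq_or_ne i m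
    · rw [topDet_ιMulti, topDet_ιMulti, det_succ_row_zero, Fin.sum_univ_succ]
      simp
      rfl
    · rw [topDet_ιMulti_of_ne hi, topDet_ιMulti_of_ne (by omega)]
  exact LinearMap.congr_fun this x

/-- The matrix `[[0, u], [0, Y]]`. -/
def border (u : Fin m → R) (Y : Matrix (Fin m) (Fin m) R) :
    Matrix (Fin (m + 1)) (Fin (m + 1)) R :=
  of (Fin.cons (Fin.cons 0 u) fun r => Fin.cons 0 (Y r))

theorem ofMatrix_border (u : Fin m → R) (Y : Matrix (Fin m) (Fin m) R) :
    ofMatrix (border u Y) = ι R (Pi.single 0 1) * map (consZero R m) (ι R u) +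
      map (consZero R m) (ofMatrix Y) := by
  have h (i : Fin m) : consZero R m (Pi.single i 1) = Pi.single i.succ 1 := by
    ext j
    refine Fin.cases ?_ (fun _ => ?_) j <;> simp [consZero_apply, Pi.single_apply]
  rw [ofMatrix_apply, ofMatrix_apply, Fin.sum_univ_succ, ι_eq_sum u]
  simp [Fin.sum_univ_succ, border, map_sum, h, Finset.mul_sum]

/-- Below the corner entry 1, column 0 vanishes: −u from the transposed border cancels u from the
rank one term. -/
theorem det_border (u v : Fin m → R) (Y : Matrix (Fin m) (Fin m) R) :
    (border u Y - (border u Y)ᵀ + vecMulVec (Fin.cons 1 u) (Fin.cons 1 v)).det =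
      (Y - Yᵀ + vecMulVec u v).det := by
  rw [det_succ_column_zero, Fin.sum_univ_succ, Finset.sum_eq_zero fun i _ => ?_]
  · simp only [border, Fin.val_zero, pow_zero, one_mul, add_zero]
    have : (of (Fin.cons (Fin.cons 0 u) fun r => Fin.cons 0 (Y r)) : Matrix _ _ R) 0 0 = 0 := rfl
    rw [Matrix.add_apply, Matrix.sub_apply, transpose_apply, this, vecMulVec_apply, Fin.cons_zero,
      Fin.cons_zero, sub_self, zero_add, one_mul, one_mul]
    congr 1
  · simp [border, vecMulVec_apply]

/-- The border term e₀ ∧ u is square-zero, so the power has two terms, and the one without e₀ has no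
top coefficient. -/
theorem topDet_ofMatrix_border_pow (u : Fin m → R) (Y : Matrix (Fin m) (Fin m) R) (k : ℕ) :
    topDet R (m + 1) (ofMatrix (border u Y) ^ (k + 1)) =
      (k + 1 : R) * topDet R m (ofMatrix Y ^ k * ι R u) := by
  have h0 : map (consZero R m) (ofMatrix Y) = ofMatrix (border 0 Y) := by
    simp [ofMatrix_border]
  have hc := ((commute_ofMatrix_ι (border 0 Y) (Pi.single 0 1)).pow_left k).eq
  rw [ofMatrix_border, add_comm (_ * _), h0, map_apply_ι, ofMatrix_add_pow_succ, map_add, ← mul_assoc _ _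
    (ι R (consZero R m u)), hc, ← h0, ← map_pow (map _), ← map_pow (map _), topDet_map_consZero,
    zero_add, ← map_apply_ι, mul_assoc, ← map_mul (map _), ← nsmul_eq_mul, map_nsmul, topDet_ι_mul_map_consZero,
    nsmul_eq_mul]
  push_cast
  rfl

theorem ofMatrix_add_pow_mul_ι_left (X : Matrix (Fin m) (Fin m) R) (u v : Fin m → R) (k : ℕ) :
    (ofMatrix X + ι R u * ι R v) ^ k * ι R u = ofMatrix X ^ k * ι R u := by
  cases k with
  | zero => simp
  | succ k =>
    rw [ofMatrix_add_pow_succ, add_mul, mul_assoc, mul_assoc, ι_mul_ι_mul_right, mul_zero,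
      mul_zero, add_zero]

theorem ofMatrix_add_pow_mul_ι (X : Matrix (Fin m) (Fin m) R) (u v : Fin m → R) (k : ℕ) :
    (ofMatrix X + ι R u * ι R v) ^ k * ι R v = ofMatrix X ^ k * ι R v := by
  cases k with
  | zero => simp
  | succ k => simp [ofMatrix_add_pow_succ, add_mul, mul_assoc]

/-- The analogue of `factorial_sq_mul_det_add_vecMulVec` in odd size. -/
theorem factorial_sq_mul_det_add_vecMulVec_odd [IsDomain R] [CharZero R] (k : ℕ)
    (Y : Matrix (Fin (2 * k + 1)) (Fin (2 * k + 1)) R) (u v : Fin (2 * k + 1) → R) :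
    (k.factorial : R) ^ 2 * (Y - Yᵀ + vecMulVec u v).det =
      topDet R _ (ofMatrix Y ^ k * ι R u) * topDet R _ (ofMatrix Y ^ k * ι R v) := by
  have h := factorial_sq_mul_det_add_vecMulVec k (border u Y) (Fin.cons 1 u) (Fin.cons 1 v)
  have hcons (w : Fin (2 * k + 1) → R) : ι R (Fin.cons 1 w : Fin (2 * k + 1 + 1) → R) =
      ι R (Pi.single 0 1) + map (consZero R _) (ι R w) := by
    rw [map_apply_ι, ← map_add]
    congr 1
    ext i
    refine Fin.cases ?_ (fun _ => ?_) i <;> simp [consZero_apply]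
  -- Since e₀ ∧ u + (e₀ + u) ∧ (e₀ + v) = e₀ ∧ v + u ∧ v, the perturbation replaces the border u by
  -- v.
  have h2 : ofMatrix (border u Y + vecMulVec (Fin.cons 1 u) (Fin.cons 1 v)) =
      ofMatrix (border v (Y + vecMulVec u v)) := by
    rw [map_add, ofMatrix_border, ofMatrix_border, ofMatrix_vecMulVec, hcons, hcons, map_add,
      map_add, ofMatrix_vecMulVec, map_mul, mul_add, add_mul, add_mul, ι_sq_zero, map_apply_ι,
      map_apply_ι, ι_mul_ι_swap (consZero R _ u) (Pi.single 0 1)]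
    abel
  have h3 := topDet_ofMatrix_border_pow u Y k
  have h4 := topDet_ofMatrix_border_pow v (Y + vecMulVec u v) k
  rw [← h2, map_add _ Y, ofMatrix_vecMulVec, ofMatrix_add_pow_mul_ι] at h4
  have h5 := det_border u v Y
  have h6 : ((k : R) + 1) ^ 2 ≠ 0 := pow_ne_zero _ (Nat.cast_add_one_ne_zero k)
  apply mul_left_cancel₀ h6
  rw [Nat.factorial_succ] at h
  push_cast at h
  have h' : ((k + 1 : R) * k.factorial) ^ 2 * (Y - Yᵀ + vecMulVec u v).det =
    ((k + 1 : R) * topDet R _ (ofMatrix Y ^ k * ι R u)) *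
      ((k + 1 : R) * topDet R _ (ofMatrix Y ^ k * ι R v)) := by
    rw [← h3, ← h4, ← h5]
    exact h
  linear_combination h'

end Border

end ExteriorAlgebra

namespace ExteriorAlgebra

/-! ### Sums over chains, by recursion on the last index. -/

section ChainSum

variable {S : Type*} [Ring S]

/-- The sum of the products `x 0 k₀ * x 1 k₁ * ⋯` of length `l` over the sequences with
`k₀ < k₁ + s 1`, `k₁ < k₂ + s 2`, …, and last term less than `N`. -/
def chainSum (x : ℕ → ℕ → S) (s : ℕ → ℕ) : ℕ → ℕ → S
  | 0, _ => 1
  | l + 1, N => ∑ j ∈ Finset.range N, chainSum x s l (j + s l) * x l j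

theorem chainSum_zero (x : ℕ → ℕ → S) (s : ℕ → ℕ) (N : ℕ) : chainSum x s 0 N = 1 := rfl

theorem chainSum_succ_succ (x : ℕ → ℕ → S) (s : ℕ → ℕ) (l N : ℕ) :
    chainSum x s (l + 1) (N + 1) = chainSum x s (l + 1) N + chainSum x s l (N + s l) * x l N := by
  simp [chainSum, Finset.sum_range_succ]

theorem chainSum_succ_zero (x : ℕ → ℕ → S) (s : ℕ → ℕ) (l : ℕ) :
    chainSum x s (l + 1) 0 = 0 := by
  simp [chainSum]

/-- `k` is a chain for the relations `k p < k q + s q` between consecutive terms, bounded by `N`. -/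
def IsBoundedChain (s : ℕ → ℕ) {n l : ℕ} (N : ℕ) (k : Fin l → Fin n) : Prop :=
  (∀ p q : Fin l, (p : ℕ) + 1 = q → (k p : ℕ) < k q + s q) ∧
    ∀ p : Fin l, (p : ℕ) + 1 = l → (k p : ℕ) < N

theorem isBoundedChain_snoc {s : ℕ → ℕ} {n l N : ℕ} {k : Fin l → Fin n} {j : Fin n} :
    IsBoundedChain s N (Fin.snoc (α := fun _ => Fin n) k j) ↔
      IsBoundedChain s (j + s l) k ∧ (j : ℕ) < N := by
  unfold IsBoundedChain
  constructor
  · rintro ⟨h1, h2⟩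
    refine ⟨⟨fun p q h => ?_, fun p h => ?_⟩, ?_⟩
    · simpa using h1 p.castSucc q.castSucc h
    · simpa using h1 p.castSucc (Fin.last l) h
    · simpa using h2 (Fin.last l) rfl
  · rintro ⟨⟨h1, h2⟩, h3⟩
    refine ⟨fun p q h => ?_, fun p h => ?_⟩
    · induction q using Fin.lastCases with
      | last =>
        induction p using Fin.lastCases with
        | last => simp at h
        | cast p => simpa using h2 p h
      | cast q =>
        induction p using Fin.lastCases with
        | last => simp at h; omega
        | cast p => simpa using h1 p q h
    · obtain rfl : p = Fin.last l := Fin.ext (by simpa using h)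
      simpa using h3

open Classical in
theorem sum_isBoundedChain (x : ℕ → ℕ → S) {s : ℕ → ℕ} (hs : ∀ l, s l ≤ 1) {n N : ℕ} (l : ℕ)
    (hN : N ≤ n) :
    ∑ k : Fin l → Fin n with IsBoundedChain s N k, (List.ofFn fun p : Fin l => x p (k p)).prod =
      chainSum x s l N := by
  induction l generalizing N with
  | zero =>
    rw [Finset.filter_true_of_mem fun k _ => ⟨fun p => p.elim0, fun p => p.elim0⟩]
    simp [chainSum]
  | succ l ih =>
    -- The bound passed to the shorter chain must not exceed n for the induction hypothesis to
    -- apply.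
    have h (j : Fin n) : (j : ℕ) + s l ≤ n := by have := hs l; omega
    have hsub : Finset.range N = (Finset.range n).filter (· < N) := by
      ext; simp; omega
    rw [Finset.sum_filter, ← (Fin.snocEquiv fun _ => Fin n).sum_comp, Fintype.sum_prod_type,
      chainSum, hsub, Finset.sum_filter,
      Finset.sum_range fun j => if j < N then chainSum x s l (j + s l) * x l j else 0]
    refine Finset.sum_congr rfl fun j _ => ?_
    have hk (k : Fin l → Fin n) : Fin.snocEquiv (fun _ => Fin n) (j, k) =
      Fin.snoc (α := fun _ => Fin n) k j := rfl
    have hprod (k : Fin l → Fin n) : (List.ofFn fun p : Fin (l + 1) =>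
        x p (Fin.snoc (α := fun _ => Fin n) k j p : Fin n)).prod =
        (List.ofFn fun p : Fin l => x p (k p)).prod * x l j := by
      rw [List.ofFn_succ', List.prod_concat]
      simp
    simp only [hk, isBoundedChain_snoc, hprod]
    split_ifs with hj
    · simp only [hj, and_true, ← ih (h j), Finset.sum_filter, Finset.sum_mul, ite_mul, zero_mul]
    · simp [hj]

end ChainSum

/-! ### Powers of the weak and strict forms as chain sums. -/

section Alternating

variable {R M : Type*} [CommRing R] [AddCommGroup M] [Module R M] (a b : ℕ → M)

/-- The sum of `a i ∧ b j` over `i ≤ j < N`. -/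
noncomputable def weakForm (R : Type*) {M : Type*} [CommRing R] [AddCommGroup M] [Module R M]
    (a b : ℕ → M) (N : ℕ) : ExteriorAlgebra R M :=
  ∑ j ∈ Finset.range N, ι R (∑ i ∈ Finset.range (j + 1), a i) * ι R (b j)

/-- The sum of `a i ∧ b j` over `i < j < N`. -/
noncomputable def strictForm (R : Type*) {M : Type*} [CommRing R] [AddCommGroup M] [Module R M]
    (a b : ℕ → M) (N : ℕ) : ExteriorAlgebra R M :=
  ∑ j ∈ Finset.range N, ι R (∑ i ∈ Finset.range j, a i) * ι R (b j)

theorem commute_weakForm_ι (N : ℕ) (z : M) : Commute (weakForm R a b N) (ι R z) :=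
  Commute.sum_left _ _ _ fun _ _ => commute_ι_mul_ι_ι _ _ _

theorem commute_strictForm_ι (N : ℕ) (z : M) : Commute (strictForm R a b N) (ι R z) :=
  Commute.sum_left _ _ _ fun _ _ => commute_ι_mul_ι_ι _ _ _

theorem weakForm_succ (N : ℕ) : weakForm R a b (N + 1) =
    weakForm R a b N + ι R (∑ i ∈ Finset.range (N + 1), a i) * ι R (b N) :=
  Finset.sum_range_succ _ _

theorem strictForm_succ (N : ℕ) : strictForm R a b (N + 1) =
    strictForm R a b N + ι R (∑ i ∈ Finset.range N, a i) * ι R (b N) :=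
  Finset.sum_range_succ _ _

/-- The full product of the sums of b and a splits into the terms i < j and the terms i ≥ j;
reversing the factors of the latter gives minus the weak form. -/
theorem strictForm_eq_weakForm_add (N : ℕ) : strictForm R b a N = weakForm R a b N +
    ι R (∑ i ∈ Finset.range N, b i) * ι R (∑ i ∈ Finset.range N, a i) := by
  induction N with
  | zero => simp [weakForm, strictForm]
  | succ N ih =>
    rw [strictForm_succ, weakForm_succ, ih, Finset.sum_range_succ b,
      ι_mul_ι_swap (∑ i ∈ Finset.range (N + 1), a i), Finset.sum_range_succ a]
    simp only [map_add, mul_add, add_mul]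
    abel

/-- The new summand of the form contains the factor multiplied by, so it contributes nothing. -/
theorem weakForm_succ_pow_mul (N k : ℕ) :
    weakForm R a b (N + 1) ^ k * ι R (∑ i ∈ Finset.range (N + 1), a i) =
      weakForm R a b N ^ k * ι R (∑ i ∈ Finset.range (N + 1), a i) := by
  cases k with
  | zero => simp
  | succ k =>
    rw [weakForm_succ, add_pow_succ_of_sq_zero ((commute_weakForm_ι a b _ _).mul_right
      (commute_weakForm_ι a b _ _)) (ι_mul_ι_mul_self _ _), add_mul, mul_assoc, mul_assoc,
      ι_mul_ι_mul_right, mul_zero, mul_zero, add_zero]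

theorem strictForm_succ_pow_mul (N k : ℕ) :
    strictForm R a b (N + 1) ^ k * ι R (∑ i ∈ Finset.range N, a i) =
      strictForm R a b N ^ k * ι R (∑ i ∈ Finset.range N, a i) := by
  cases k with
  | zero => simp
  | succ k =>
    rw [strictForm_succ, add_pow_succ_of_sq_zero ((commute_strictForm_ι a b _ _).mul_right
      (commute_strictForm_ι a b _ _)) (ι_mul_ι_mul_self _ _), add_mul, mul_assoc, mul_assoc,
      ι_mul_ι_mul_right, mul_zero, mul_zero, add_zero]

/-- The letters `a` and `b` in turn. -/
noncomputable def altLetter (R : Type*) {M : Type*} [CommRing R] [AddCommGroup M] [Module R M]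
    (a b : ℕ → M) (p j : ℕ) : ExteriorAlgebra R M :=
  ι R (if Even p then a j else b j)

theorem chainSum_weak_odd {k : ℕ}
    (h : ∀ N, (k.factorial : ExteriorAlgebra R M) *
      chainSum (altLetter R a b) (fun l => l % 2) (2 * k) N = weakForm R a b N ^ k) (N : ℕ) :
    (k.factorial : ExteriorAlgebra R M) *
      chainSum (altLetter R a b) (fun l => l % 2) (2 * k + 1) N =
        weakForm R a b N ^ k * ι R (∑ i ∈ Finset.range N, a i) := by
  induction N with
  | zero => simp [chainSum_succ_zero]
  | succ N ih =>
    have : altLetter R a b (2 * k) N = ι R (a N) := by simp [altLetter]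
    rw [chainSum_succ_succ, mul_add, ih, weakForm_succ_pow_mul, ← mul_assoc, h, this,
      Finset.sum_range_succ, map_add, mul_add, Nat.mul_mod_right, add_zero]

/-- Chains ending in b N supply exactly the mixed term in the two-term expansion of the (k + 1)-st
power at N + 1. -/
theorem chainSum_weak_even_succ {k : ℕ}
    (h : ∀ N, (k.factorial : ExteriorAlgebra R M) *
      chainSum (altLetter R a b) (fun l => l % 2) (2 * k + 1) N =
        weakForm R a b N ^ k * ι R (∑ i ∈ Finset.range N, a i)) (N : ℕ) :
    ((k + 1).factorial : ExteriorAlgebra R M) *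
      chainSum (altLetter R a b) (fun l => l % 2) (2 * k + 1 + 1) N =
        weakForm R a b N ^ (k + 1) := by
  induction N with
  | zero => simp [chainSum_succ_zero, weakForm]
  | succ N ih =>
    have h1 : altLetter R a b (2 * k + 1) N = ι R (b N) := by simp [altLetter]
    have h2 : (2 * k + 1) % 2 = 1 := by omega
    rw [chainSum_succ_succ, mul_add, ih, h1, h2, Nat.factorial_succ, Nat.cast_mul, mul_assoc,
      ← mul_assoc (k.factorial : ExteriorAlgebra R M), h, weakForm_succ_pow_mul, weakForm_succ,
      add_pow_succ_of_sq_zero ((commute_weakForm_ι a b _ _).mul_right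
      (commute_weakForm_ι a b _ _)) (ι_mul_ι_mul_self _ _), mul_assoc (weakForm R a b N ^ k)]

theorem chainSum_weak_even (k N : ℕ) : (k.factorial : ExteriorAlgebra R M) *
    chainSum (altLetter R a b) (fun l => l % 2) (2 * k) N = weakForm R a b N ^ k := by
  induction k generalizing N with
  | zero => simp [chainSum_zero]
  | succ k ih => exact chainSum_weak_even_succ a b (chainSum_weak_odd a b ih) N

/-- The step into the last letter a N is weak here, so the shorter chains are bounded by N + 1; the
old term is therefore rewritten with the form at N + 1. -/
theorem chainSum_strict_odd {k : ℕ}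
    (h : ∀ N, (k.factorial : ExteriorAlgebra R M) *
      chainSum (altLetter R a b) (fun l => (l + 1) % 2) (2 * k) N = strictForm R a b N ^ k)
    (N : ℕ) :
    (k.factorial : ExteriorAlgebra R M) *
      chainSum (altLetter R a b) (fun l => (l + 1) % 2) (2 * k + 1) N =
        strictForm R a b N ^ k * ι R (∑ i ∈ Finset.range N, a i) := by
  induction N with
  | zero => simp [chainSum_succ_zero]
  | succ N ih =>
    have h1 : altLetter R a b (2 * k) N = ι R (a N) := by simp [altLetter]
    have h2 : (2 * k + 1) % 2 = 1 := by omega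
    rw [chainSum_succ_succ, mul_add, ih, ← strictForm_succ_pow_mul, ← mul_assoc, h2, h, h1,
      Finset.sum_range_succ, map_add, mul_add]

theorem chainSum_strict_even_succ {k : ℕ}
    (h : ∀ N, (k.factorial : ExteriorAlgebra R M) *
      chainSum (altLetter R a b) (fun l => (l + 1) % 2) (2 * k + 1) N =
        strictForm R a b N ^ k * ι R (∑ i ∈ Finset.range N, a i)) (N : ℕ) :
    ((k + 1).factorial : ExteriorAlgebra R M) *
      chainSum (altLetter R a b) (fun l => (l + 1) % 2) (2 * k + 1 + 1) N =
        strictForm R a b N ^ (k + 1) := by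
  induction N with
  | zero => simp [chainSum_succ_zero, strictForm]
  | succ N ih =>
    have h1 : altLetter R a b (2 * k + 1) N = ι R (b N) := by simp [altLetter]
    have h2 : (2 * k + 1 + 1) % 2 = 0 := by omega
    rw [chainSum_succ_succ, mul_add, ih, h1, h2, add_zero, Nat.factorial_succ, Nat.cast_mul,
      mul_assoc, ← mul_assoc (k.factorial : ExteriorAlgebra R M), h, strictForm_succ,
      add_pow_succ_of_sq_zero ((commute_strictForm_ι a b _ _).mul_right
      (commute_strictForm_ι a b _ _)) (ι_mul_ι_mul_self _ _), mul_assoc (strictForm R a b N ^ k)]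

theorem chainSum_strict_even (k N : ℕ) : (k.factorial : ExteriorAlgebra R M) *
    chainSum (altLetter R a b) (fun l => (l + 1) % 2) (2 * k) N = strictForm R a b N ^ k := by
  induction k generalizing N with
  | zero => simp [chainSum_zero]
  | succ k ih => exact chainSum_strict_even_succ a b (chainSum_strict_odd a b ih) N

end Alternating

end ExteriorAlgebra

/-! ### Application to the columns of A and B. -/

section Columns

variable {R : Type*} [CommRing R] {m n : ℕ}

/-- The columns of a matrix as a sequence, continued by zeros. -/
def colSeq (A : Matrix (Fin m) (Fin n) R) (j : ℕ) : Fin m → R :=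
  fun r => if h : j < n then A r ⟨j, h⟩ else 0

theorem colSeq_fin (A : Matrix (Fin m) (Fin n) R) (j : Fin n) : colSeq A j = fun r => A r j := by
  ext r
  simp [colSeq]

theorem sum_colSeq (A : Matrix (Fin m) (Fin n) R) :
    ∑ i ∈ Finset.range n, colSeq A i = fun r => ∑ i, A r i := by
  ext r
  simp [Finset.sum_range, colSeq_fin]

theorem sum_colSeq_succ (A : Matrix (Fin m) (Fin n) R) (j : Fin n) :
    ∑ i ∈ Finset.range (j + 1), colSeq A i = fun r => (A * (upperOnes R n + 1) : Matrix _ _ R) r j := by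
  have hsub : Finset.range (j + 1) = (Finset.range n).filter (· ≤ (j : ℕ)) := by
    ext; simp; omega
  ext r
  rw [hsub, Finset.sum_filter, Finset.sum_range fun i => if i ≤ (j : ℕ) then colSeq A i else 0,
    Matrix.mul_apply, Finset.sum_apply]
  refine Finset.sum_congr rfl fun i _ => ?_
  rcases lt_trichotomy i j with h | rfl | h
  · simp [upperOnes, h, h.le, h.ne, colSeq_fin]
  · simp [upperOnes, colSeq_fin]
  · simp [upperOnes, h.not_gt, h.not_ge, h.ne']

open ExteriorAlgebra

theorem ofMatrix_mul_upperOnes_mul (A B : Matrix (Fin m) (Fin n) R) :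
    ofMatrix (A * (upperOnes R n + 1) * Bᵀ) = weakForm R (colSeq A) (colSeq B) n := by
  have h : A * (upperOnes R n + 1) * Bᵀ =
      ∑ j : Fin n, vecMulVec (fun r => (A * (upperOnes R n + 1) : Matrix _ _ R) r j) (fun r => B r j) := by
    ext r s
    rw [Matrix.mul_apply, Matrix.sum_apply]
    rfl
  rw [h, map_sum, weakForm, Finset.sum_range]
  simp only [ofMatrix_vecMulVec, sum_colSeq_succ, colSeq_fin]

theorem mul_upperOnes_mul_eq (A B : Matrix (Fin m) (Fin n) R) :
    A * upperOnes R n * Bᵀ + B * upperOnes R n * Aᵀ + A * Bᵀ =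
      A * (upperOnes R n + 1) * Bᵀ - (A * (upperOnes R n + 1) * Bᵀ)ᵀ +
        vecMulVec (∑ i ∈ Finset.range n, colSeq B i) (∑ i ∈ Finset.range n, colSeq A i) := by
  have h1 : vecMulVec (∑ i ∈ Finset.range n, colSeq B i) (∑ i ∈ Finset.range n, colSeq A i) =
      B * (of fun _ _ => 1 : Matrix (Fin n) (Fin n) R) * Aᵀ := by
    ext r s
    simp [sum_colSeq, vecMulVec_apply, Matrix.mul_apply, Finset.mul_sum]
  have h2 : (of fun _ _ => 1 : Matrix (Fin n) (Fin n) R) = upperOnes R n + 1 + (upperOnes R n)ᵀ := by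
    ext i j
    rcases lt_trichotomy i j with h | rfl | h
    · simp [upperOnes, h, h.not_gt, h.ne]
    · simp [upperOnes]
    · simp [upperOnes, h, h.not_gt, h.ne']
  rw [h1, h2]
  simp only [transpose_mul, transpose_add, transpose_transpose, Matrix.mul_add,
    Matrix.add_mul, Matrix.mul_one, Matrix.mul_assoc]
  abel

theorem weakStrict_iff {k : Fin m → Fin n} : WeakStrict k ↔ IsBoundedChain (fun l => l % 2) n k := by
  simp only [WeakStrict, IsBoundedChain, Fin.is_lt, implies_true, and_true]
  refine forall_congr' fun p => forall_congr' fun q => imp_congr_right fun h => ?_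
  rcases Nat.even_or_odd (p : ℕ) with hp | hp
  · have : (q : ℕ) % 2 = 1 := by grind
    simp [hp, this]
  · have : (q : ℕ) % 2 = 0 := by grind
    simp [hp, this, Nat.not_even_iff_odd.2 hp]

theorem strictWeak_iff {k : Fin m → Fin n} :
    StrictWeak k ↔ IsBoundedChain (fun l => (l + 1) % 2) n k := by
  simp only [StrictWeak, IsBoundedChain, Fin.is_lt, implies_true, and_true]
  refine forall_congr' fun p => forall_congr' fun q => imp_congr_right fun h => ?_
  rcases Nat.even_or_odd (p : ℕ) with hp | hp
  · have : ((q : ℕ) + 1) % 2 = 0 := by grind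
    simp [hp, this, Nat.not_odd_iff_even.2 hp]
  · have : ((q : ℕ) + 1) % 2 = 1 := by grind
    simp [hp, this, Nat.not_even_iff_odd.2 hp]

theorem det_altColumns (A B : Matrix (Fin m) (Fin n) R) (k : Fin m → Fin n) :
    (altColumns A B k).det = topDet R m
      (List.ofFn fun p : Fin m => altLetter R (colSeq A) (colSeq B) p (k p)).prod := by
  have : (List.ofFn fun p : Fin m => altLetter R (colSeq A) (colSeq B) p (k p)).prod =
      ιMulti R m fun p r => altColumns A B k r p := by
    rw [ιMulti_apply]
    congr 2
    ext1 p
    rw [altLetter, colSeq_fin, colSeq_fin]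
    congr 1
    ext r
    by_cases hp : Even (p : ℕ) <;> simp [altColumns, hp]
  rw [this, topDet_ιMulti, ← det_transpose]
  rfl

theorem sum_weakStrict (A B : Matrix (Fin m) (Fin n) R) :
    ∑ k : Fin m → Fin n with WeakStrict k, (altColumns A B k).det =
      topDet R m (chainSum (altLetter R (colSeq A) (colSeq B)) (fun l => l % 2) m n) := by
  classical
  rw [← sum_isBoundedChain _ (fun l => by omega) m le_rfl, map_sum]
  simp only [det_altColumns, weakStrict_iff]

theorem sum_strictWeak (A B : Matrix (Fin m) (Fin n) R) :
    ∑ k : Fin m → Fin n with StrictWeak k, (altColumns A B k).det =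
      topDet R m (chainSum (altLetter R (colSeq A) (colSeq B)) (fun l => (l + 1) % 2) m n) := by
  classical
  rw [← sum_isBoundedChain _ (fun l => by omega) m le_rfl, map_sum]
  simp only [det_altColumns, strictWeak_iff]

theorem det_eq_sum_mul_sum_of_isDomain [IsDomain R] [CharZero R] (hm : 0 < m)
    (A B : Matrix (Fin m) (Fin n) R) :
    (A * upperOnes R n * Bᵀ + B * upperOnes R n * Aᵀ + A * Bᵀ).det =
      (∑ k : Fin m → Fin n with WeakStrict k, (altColumns A B k).det) *
        ∑ k : Fin m → Fin n with StrictWeak k, (altColumns B A k).det := by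
  have top_mul (k : ℕ) (x : ExteriorAlgebra R (Fin m → R)) :
      (k.factorial : R) * topDet R m x = topDet R m ((k.factorial : ExteriorAlgebra R _) * x) := by
    rw [← nsmul_eq_mul, ← nsmul_eq_mul, map_nsmul]
  have hc (k : ℕ) : (k.factorial : R) ^ 2 ≠ 0 :=
    pow_ne_zero _ (Nat.cast_ne_zero.2 k.factorial_ne_zero)
  rw [sum_weakStrict, sum_strictWeak, mul_upperOnes_mul_eq]
  rcases Nat.even_or_odd' m with ⟨k, rfl | rfl⟩
  · obtain ⟨k, rfl⟩ : ∃ l, k = l + 1 := ⟨k - 1, by omega⟩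
    apply mul_left_cancel₀ (hc (k + 1))
    rw [factorial_sq_mul_det_add_vecMulVec, map_add, ofMatrix_vecMulVec,
      ofMatrix_mul_upperOnes_mul, ← strictForm_eq_weakForm_add, ← chainSum_weak_even,
      ← chainSum_strict_even, ← top_mul, ← top_mul]
    ring
  · apply mul_left_cancel₀ (hc k)
    -- Since (ω + b ∧ a)^k ∧ b = ω^k ∧ b, the factor with b can be read in the strict form, while
    -- the factor with a stays in the weak form.
    rw [factorial_sq_mul_det_add_vecMulVec_odd, ← ofMatrix_add_pow_mul_ι_left _ _
      (∑ i ∈ Finset.range n, colSeq A i), ofMatrix_mul_upperOnes_mul,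
      ← strictForm_eq_weakForm_add, ← chainSum_weak_odd _ _ (chainSum_weak_even _ _ k),
      ← chainSum_strict_odd _ _ (chainSum_strict_even _ _ k), ← top_mul, ← top_mul]
    ring

end Columns

theorem theorem5p6 {R : Type*} [CommRing R] (m n : ℕ) (hm : 0 < m) (hn : 0 < n)
    (A B : Matrix (Fin m) (Fin n) R) :
    Matrix.det (A * upperOnes R n * B.transpose + B * upperOnes R n * A.transpose
        + A * B.transpose)
      = (∑ k : Fin m → Fin n with WeakStrict k, Matrix.det (altColumns A B k))
        * (∑ k : Fin m → Fin n with StrictWeak k, Matrix.det (altColumns B A k)) := by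
  -- Generic matrices: independent variables over ℤ generate a domain of characteristic zero, and
  -- `f` specialises them to A and B.
  let A₀ : Matrix (Fin m) (Fin n) (MvPolynomial (Bool × Fin m × Fin n) ℤ) :=
    of fun i j => MvPolynomial.X (true, i, j)
  let B₀ : Matrix (Fin m) (Fin n) (MvPolynomial (Bool × Fin m × Fin n) ℤ) :=
    of fun i j => MvPolynomial.X (false, i, j)
  let f : MvPolynomial (Bool × Fin m × Fin n) ℤ →+* R :=
    MvPolynomial.eval₂Hom (Int.castRingHom R) fun x => if x.1 then A x.2.1 x.2.2 else B x.2.1 x.2.2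
  have hA : A₀.map f = A := by ext; simp [A₀, f]
  have hB : B₀.map f = B := by ext; simp [B₀, f]
  have hU : (upperOnes _ n).map f = upperOnes R n := by ext; simp [upperOnes, apply_ite f]
  have hcol (C D : Matrix (Fin m) (Fin n) (MvPolynomial (Bool × Fin m × Fin n) ℤ))
      (k : Fin m → Fin n) : f.mapMatrix (altColumns C D k) = altColumns (C.map f) (D.map f) k := by
    ext
    simp [altColumns, apply_ite f]
  have h := congrArg f (det_eq_sum_mul_sum_of_isDomain hm A₀ B₀)
  rw [RingHom.map_det, RingHom.mapMatrix_apply, Matrix.map_add _ (map_add f),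
    Matrix.map_add _ (map_add f), Matrix.map_mul, Matrix.map_mul, Matrix.map_mul, Matrix.map_mul,
    Matrix.map_mul, transpose_map, transpose_map, map_mul, map_sum, map_sum] at h
  simpa only [RingHom.map_det, hcol, hA, hB, hU] using h
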